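/- For a finite Borel measure $\mu$ on $\mathbb{R}^d$ write $\widehat{\mu}(\xi)=\int_{\mathbb{R}^d} e^{-2\pi i x\cdot\xi}\,d\mu(x)$. A set $A\subset\mathbb{R}^d$ is called a Salem set if for every $0<s<\dim_{\mathcal H}A$ there is a nonzero finite Borel measure $\mu$ on $\mathbb{R}^d$ with compact support contained in $A$ such that $|\widehat{\mu}(\xi)|\le|\xi|^{-s/2}$ for all $\xi\in\mathbb{R}^d\setminus\{0\}$. Theorem 1.4. Let $E\subset\mathbb{R}^d$ be the disjoint union of two compact Salem sets $E_1$ and $E_2$ with $\dim_{\mathcal H}E_1>\frac d2$ and $\dim_{\mathcal H}E_2>\frac d2$. Then the set $$\mathcal{S}(E)=\left\{\frac{x-y}{|x-y|}\in\mathbb{S}^{d-1}: x,y\in E,\ x\ne y\right\}$$ has positive $(d-1)$-dimensional Hausdorff measure, that is, $H^{d-1}(\mathcal{S}(E))>0$. -/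

import Mathlib

open MeasureTheory
open scoped ENNReal

/-- The Fourier transform `μ̂(ξ) = ∫ e^{-2πi x·ξ} dμ(x)` of a measure on `ℝ^d`. -/
noncomputable def measureFourier {d : ℕ} (μ : Measure (EuclideanSpace ℝ (Fin d)))
    (ξ : EuclideanSpace ℝ (Fin d)) : ℂ :=
  ∫ x, Complex.exp (-(2 * (Real.pi : ℂ) * Complex.I * ((inner ℝ x ξ : ℝ) : ℂ))) ∂μ

/-- The class `M(E)` of nonzero finite Borel measures on `ℝ^d` with compact support
contained in `E`. -/
structure IsMeasureOn {d : ℕ} (E : Set (EuclideanSpace ℝ (Fin d)))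
    (μ : Measure (EuclideanSpace ℝ (Fin d))) : Prop where
  finite : IsFiniteMeasure μ
  ne_zero : μ ≠ 0
  support : ∃ K ⊆ E, IsCompact K ∧ μ Kᶜ = 0

/-- `E ⊆ ℝ^d` is a Salem set: for every `0 < s < dim_H E` there is `μ ∈ M(E)` with
`|μ̂(ξ)| ≤ |ξ|^{-s/2}` for all `ξ ≠ 0`. (At `ξ = 0` the right-hand side is `+∞`, whereas the
real power in Lean takes the value `0` there, so this point is left out.) -/
def IsSalem {d : ℕ} (E : Set (EuclideanSpace ℝ (Fin d))) : Prop :=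
  ∀ s : ℝ, 0 < s → ENNReal.ofReal s < dimH E →
    ∃ μ : Measure (EuclideanSpace ℝ (Fin d)), IsMeasureOn E μ ∧
      ∀ ξ : EuclideanSpace ℝ (Fin d), ξ ≠ 0 → ‖measureFourier μ ξ‖ ≤ ‖ξ‖ ^ (-s / 2)

/-- The set `S(E)` of unit vectors `(x - y)/|x - y|` with `x, y ∈ E`, `x ≠ y`. -/
def directionSet {d : ℕ} (E : Set (EuclideanSpace ℝ (Fin d))) :
    Set (EuclideanSpace ℝ (Fin d)) :=
  {ω | ∃ x ∈ E, ∃ y ∈ E, x ≠ y ∧ ω = ‖x - y‖⁻¹ • (x - y)}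

open scoped FourierTransform SchwartzMap

/-! Choose `s` with `d/2 < s` below both dimensions, and Salem measures `μ₁`, `μ₂` for it. The image
`ν` of `μ₁ × μ₂` under subtraction has Fourier transform of size at most `|ξ|^{-s}`, which is square
integrable as `2s > d`. By Plancherel `ν` charges no Lebesgue-null compact set, so some compact `K₁
- K₂` has positive volume (`volume_sub_pos_of_fourier_decay`). Disjointness keeps `0` out of it. If
its directions were `H^{d-1}`-null, it would lie in a Lebesgue-null cone
(`volume_eq_zero_of_hausdorffMeasure_directions_eq_zero`), a contradiction. -/

/-! ### Fourier transforms of finite measures -/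

lemma norm_measureFourier_le {d : ℕ} (ν : Measure (EuclideanSpace ℝ (Fin d)))
    (ξ : EuclideanSpace ℝ (Fin d)) : ‖measureFourier ν ξ‖ ≤ ν.real Set.univ := by
  unfold measureFourier
  refine (norm_integral_le_integral_norm _).trans (le_of_eq ?_)
  have h : ∀ x : EuclideanSpace ℝ (Fin d),
      ‖Complex.exp (-(2 * (Real.pi : ℂ) * Complex.I * ((inner ℝ x ξ : ℝ) : ℂ)))‖ = 1 := by
    intro x
    simp [Complex.norm_exp]
  simp [h]

lemma continuous_measureFourier {d : ℕ} (ν : Measure (EuclideanSpace ℝ (Fin d)))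
    [IsFiniteMeasure ν] : Continuous (measureFourier ν) := by
  unfold measureFourier
  refine continuous_of_dominated (bound := fun _ => 1) ?_ ?_ (integrable_const _) ?_
  · intro ξ
    exact Continuous.aestronglyMeasurable (by fun_prop)
  · intro ξ
    refine Filter.Eventually.of_forall fun x => ?_
    simp [Complex.norm_exp]
  · refine Filter.Eventually.of_forall fun x => ?_
    fun_prop

/-- Fourier inversion for a Schwartz function, integrated against a finite measure. -/
lemma integral_schwartz_eq_integral_fourier {d : ℕ} (ν : Measure (EuclideanSpace ℝ (Fin d)))
    [IsFiniteMeasure ν] (f : 𝓢(EuclideanSpace ℝ (Fin d), ℂ)) :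
    ∫ x, f x ∂ν = ∫ ξ, (𝓕 f) ξ * measureFourier ν (-ξ) := by
  have hinv : ∀ x, f x = ∫ ξ, (𝓕 f) ξ *
      Complex.exp (-(2 * (Real.pi : ℂ) * Complex.I * ((inner ℝ x (-ξ) : ℝ) : ℂ))) := by
    intro x
    conv_lhs =>
      rw [← FourierTransform.fourierInv_fourier_eq (F := 𝓢(EuclideanSpace ℝ (Fin d), ℂ)) f]
    rw [SchwartzMap.fourierInv_coe, Real.fourierInv_eq']
    refine integral_congr_ae (Filter.Eventually.of_forall fun ξ => ?_)
    simp only [smul_eq_mul, inner_neg_right, real_inner_comm]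
    rw [mul_comm]
    congr 2
    push_cast
    ring
  simp_rw [hinv]
  rw [integral_integral_swap]
  · refine integral_congr_ae (Filter.Eventually.of_forall fun ξ => ?_)
    simp only [measureFourier]
    exact integral_const_mul _ _
  · have h1 : Integrable (fun p : EuclideanSpace ℝ (Fin d) × EuclideanSpace ℝ (Fin d) =>
        (𝓕 f) p.2) (ν.prod volume) := by
      have := (integrable_const (μ := ν) (1 : ℂ)).mul_prod ((𝓕 f).integrable (μ := volume))
      simpa using this
    refine h1.mul_bdd (c := 1) (Continuous.aestronglyMeasurable (by fun_prop)) ?_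
    refine Filter.Eventually.of_forall fun p => ?_
    simp [Complex.norm_exp]

/-- The decay gives integrability at infinity because `2s > d`; near the origin, where `|ξ|^{-2s}`
is not integrable, the total mass serves as the bound. -/
lemma integrable_norm_measureFourier_sq {d : ℕ} (ν : Measure (EuclideanSpace ℝ (Fin d)))
    [IsFiniteMeasure ν] {s : ℝ} (hs0 : 0 < s) (hs : (d : ℝ) < 2 * s)
    (hν : ∀ ξ : EuclideanSpace ℝ (Fin d), ξ ≠ 0 → ‖measureFourier ν ξ‖ ≤ ‖ξ‖ ^ (-s)) :
    Integrable (fun ξ => ‖measureFourier ν ξ‖ ^ 2) := by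
  have hint : Integrable (fun ξ : EuclideanSpace ℝ (Fin d) => (1 + ‖ξ‖) ^ (-(2 * s))) :=
    integrable_one_add_norm (by simpa using hs)
  refine (hint.const_mul (2 ^ (2 * s) * (1 + ν.real Set.univ ^ 2))).mono'
    ((continuous_measureFourier ν).norm.pow 2).aestronglyMeasurable
    (Filter.Eventually.of_forall fun ξ => ?_)
  rw [Real.norm_of_nonneg (by positivity)]
  -- `(1 + |ξ|)/2` is at most `|ξ|` when `|ξ| ≥ 1` and at most `1` otherwise, so its negative power
  -- dominates in both regimes.
  have h2 : (2 : ℝ) ^ (2 * s) * (1 + ‖ξ‖) ^ (-(2 * s)) = ((1 + ‖ξ‖) / 2) ^ (-(2 * s)) := by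
    rw [Real.div_rpow (by positivity) (by norm_num), Real.rpow_neg (x := 2) (by norm_num)]
    field_simp
  have key : ‖measureFourier ν ξ‖ ^ 2 ≤
      (1 + ν.real Set.univ ^ 2) * ((1 + ‖ξ‖) / 2) ^ (-(2 * s)) := by
    rcases le_total 1 ‖ξ‖ with h | h
    · have hξ : ξ ≠ 0 := norm_pos_iff.1 (by linarith)
      calc ‖measureFourier ν ξ‖ ^ 2 ≤ (‖ξ‖ ^ (-s)) ^ 2 := by gcongr; exact hν ξ hξ
        _ = ‖ξ‖ ^ (-(2 * s)) := by
          rw [← Real.rpow_natCast, ← Real.rpow_mul (norm_nonneg _)]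
          congr 1
          push_cast
          ring
        _ ≤ ((1 + ‖ξ‖) / 2) ^ (-(2 * s)) :=
          Real.rpow_le_rpow_of_nonpos (by positivity) (by linarith) (by linarith)
        _ ≤ _ := le_mul_of_one_le_left (by positivity) (by nlinarith [sq_nonneg (ν.real Set.univ)])
    · have h1 : 1 ≤ ((1 + ‖ξ‖) / 2) ^ (-(2 * s)) :=
        Real.one_le_rpow_of_pos_of_le_one_of_nonpos (by positivity) (by linarith) (by linarith)
      calc ‖measureFourier ν ξ‖ ^ 2 ≤ ν.real Set.univ ^ 2 := by
            gcongr; exact norm_measureFourier_le ν ξ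
        _ ≤ 1 + ν.real Set.univ ^ 2 := by linarith
        _ ≤ _ := le_mul_of_one_le_right (by positivity) h1
  linarith [key, congrArg (fun t => (1 + ν.real Set.univ ^ 2) * t) h2]

/-- A finite measure whose Fourier transform is square integrable does not charge
Lebesgue-null compact sets. -/
lemma measure_eq_zero_of_integrable_measureFourier_sq {d : ℕ}
    (ν : Measure (EuclideanSpace ℝ (Fin d))) [IsFiniteMeasure ν]
    (hν : Integrable (fun ξ => ‖measureFourier ν ξ‖ ^ 2))
    {K : Set (EuclideanSpace ℝ (Fin d))} (hK : IsCompact K) (hK0 : volume K = 0) : ν K = 0 := by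
  set G : EuclideanSpace ℝ (Fin d) → ℂ := fun ξ => measureFourier ν (-ξ) with hG
  have hGc : Continuous G := (continuous_measureFourier ν).comp continuous_neg
  have hGm : MemLp G 2 := (memLp_two_iff_integrable_sq_norm hGc.aestronglyMeasurable).2 hν.comp_neg
  set A : ℝ := (∫ ξ, ‖G ξ‖ ^ (2 : ℝ)) ^ (1 / (2 : ℝ)) with hA
  -- Fourier inversion, Cauchy–Schwarz and Plancherel: `ν` acts as an `L²`-bounded functional on
  -- Schwartz functions.
  have hbound : ∀ f : 𝓢(EuclideanSpace ℝ (Fin d), ℂ),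
      ‖∫ x, f x ∂ν‖ ≤ (∫ x, ‖f x‖ ^ 2) ^ (1 / (2 : ℝ)) * A := by
    intro f
    rw [integral_schwartz_eq_integral_fourier ν f]
    refine (norm_integral_le_integral_norm _).trans ?_
    simp_rw [norm_mul]
    refine (integral_mul_norm_le_Lp_mul_Lq (p := 2) (q := 2) (g := G) Real.HolderConjugate.two_two
      (by simpa using (𝓕 f).memLp 2) (by simpa using hGm)).trans (le_of_eq ?_)
    rw [← SchwartzMap.integral_norm_sq_fourier f]
    simp [hA]
  -- Tested on a smooth cutoff equal to `1` on `K` and vanishing off its `δ`-thickening.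
  have hle : ∀ δ : ℝ, 0 < δ →
      ν.real K ≤ (volume.real (Metric.cthickening δ K)) ^ (1 / (2 : ℝ)) * A := by
    intro δ hδ
    have hT : IsCompact (Metric.cthickening δ K) := hK.cthickening
    obtain ⟨g, hg1, hg0, hg⟩ := exists_contMDiffMap_one_nhds_of_subset_interior
      (modelWithCornersSelf ℝ (EuclideanSpace ℝ (Fin d))) (n := (⊤ : ℕ∞)) hK.isClosed
      ((Metric.self_subset_thickening hδ K).trans
        (interior_maximal (Metric.thickening_subset_cthickening δ K) Metric.isOpen_thickening))
    have hgc : ContDiff ℝ (⊤ : ℕ∞) g := g.contMDiff.contDiff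
    have hsupp : HasCompactSupport (fun x => (g x : ℂ)) :=
      HasCompactSupport.intro hT fun x hx => by simp [hg0 x hx]
    let f : 𝓢(EuclideanSpace ℝ (Fin d), ℂ) :=
      hsupp.toSchwartzMap (Complex.ofRealCLM.contDiff.comp hgc)
    have hf : ∀ x, f x = (g x : ℂ) := fun x => rfl
    have hgi : Integrable (fun x => g x) ν := by
      refine (integrable_const (1 : ℝ)).mono' hgc.continuous.aestronglyMeasurable
        (Filter.Eventually.of_forall fun x => ?_)
      rw [Real.norm_of_nonneg (hg x).1]
      exact (hg x).2
    have h1 : ν.real K ≤ ‖∫ x, f x ∂ν‖ := by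
      simp_rw [hf]
      rw [integral_complex_ofReal, Complex.norm_real]
      refine le_trans ?_ (le_abs_self _)
      rw [← integral_indicator_one hK.measurableSet]
      refine integral_mono ((integrable_const (1 : ℝ)).indicator hK.measurableSet) hgi fun x => ?_
      by_cases hx : x ∈ K
      · simp [hx, hg1.self_of_nhdsSet x hx]
      · simpa [hx] using (hg x).1
    have h2 : ∫ x, ‖f x‖ ^ 2 ≤ volume.real (Metric.cthickening δ K) := by
      rw [← integral_indicator_one hT.measurableSet]
      refine integral_mono_of_nonneg (Filter.Eventually.of_forall fun x => by positivity)
        ((integrable_indicator_iff hT.measurableSet).2 (integrableOn_const hT.measure_lt_top.ne))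
        (Filter.Eventually.of_forall fun x => ?_)
      by_cases hx : x ∈ Metric.cthickening δ K
      · simp only [hf, Complex.norm_real, Set.indicator_of_mem hx, Pi.one_apply]
        rw [Real.norm_of_nonneg (hg x).1]
        exact pow_le_one₀ (hg x).1 (hg x).2
      · simp [hf, hx, hg0 x hx]
    refine (h1.trans (hbound f)).trans ?_
    have hA0 : 0 ≤ A := by positivity
    gcongr
  have hlim : Filter.Tendsto
      (fun δ : ℝ => (volume.real (Metric.cthickening δ K)) ^ (1 / (2 : ℝ)) * A)
      (nhdsWithin 0 (Set.Ioi 0)) (nhds 0) := by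
    have h := (ENNReal.tendsto_toReal (by simp [hK0])).comp
      (tendsto_measure_cthickening_of_isCompact (μ := volume) hK)
    rw [hK0] at h
    have h' := ((h.mono_left (nhdsWithin_le_nhds (s := Set.Ioi 0))).rpow_const (p := 1 / (2 : ℝ))
      (Or.inr (by norm_num))).mul_const A
    simpa [Function.comp_def, Measure.real] using h'
  have h0 : ν.real K ≤ 0 := ge_of_tendsto hlim
    (by filter_upwards [self_mem_nhdsWithin] with δ hδ using hle δ hδ)
  exact (measureReal_eq_zero_iff).1 (le_antisymm h0 measureReal_nonneg)

/-- The image measure is the convolution of `μ₁` with the reflection of `μ₂`. -/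
lemma measureFourier_map_sub_prod {d : ℕ} (μ₁ μ₂ : Measure (EuclideanSpace ℝ (Fin d)))
    [IsFiniteMeasure μ₁] [IsFiniteMeasure μ₂] (ξ : EuclideanSpace ℝ (Fin d)) :
    measureFourier ((μ₁.prod μ₂).map fun p => p.1 - p.2) ξ =
      measureFourier μ₁ ξ * measureFourier μ₂ (-ξ) := by
  unfold measureFourier
  rw [integral_map (by fun_prop) (Continuous.aestronglyMeasurable (by fun_prop)),
    ← integral_prod_mul]
  refine integral_congr_ae (Filter.Eventually.of_forall fun p => ?_)
  simp only [← Complex.exp_add, inner_sub_left, inner_neg_right]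
  congr 1
  push_cast
  ring

/-! ### Null sets, charts and cones -/

/-- A `C¹` image of an `H^r`-null set is `H^r`-null. -/
lemma hausdorffMeasure_image_eq_zero_of_contDiffAt {X Y : Type*}
    [NormedAddCommGroup X] [NormedSpace ℝ X] [MeasurableSpace X] [BorelSpace X]
    [SecondCountableTopology X]
    [NormedAddCommGroup Y] [NormedSpace ℝ Y] [MeasurableSpace Y] [BorelSpace Y]
    {f : X → Y} {S : Set X} {r : ℝ} (hr : 0 ≤ r) (hf : ∀ x ∈ S, ContDiffAt ℝ 1 f x)
    (hS : Measure.hausdorffMeasure r S = 0) : Measure.hausdorffMeasure r (f '' S) = 0 := by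
  have h : ∀ x ∈ S, ∃ t ∈ nhdsWithin x S, Measure.hausdorffMeasure r (f '' (t ∩ S)) = 0 := by
    intro x hx
    obtain ⟨C, t, ht, hC⟩ := (hf x hx).exists_lipschitzOnWith
    refine ⟨t, mem_nhdsWithin_of_mem_nhds ht, le_antisymm ?_ zero_le⟩
    refine ((hC.mono Set.inter_subset_left).hausdorffMeasure_image_le hr).trans ?_
    rw [measure_mono_null Set.inter_subset_right hS, mul_zero]
  choose! u hu hu0 using h
  obtain ⟨T, hTS, hT, hcov⟩ := TopologicalSpace.countable_cover_nhdsWithin hu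
  refine measure_mono_null ?_ ((measure_biUnion_null_iff hT).2 fun x hx => hu0 x (hTS hx))
  rintro _ ⟨x, hx, rfl⟩
  obtain ⟨y, hy, hxy⟩ := Set.mem_iUnion₂.1 (hcov hx)
  exact Set.mem_iUnion₂.2 ⟨y, hy, x, ⟨hxy, hx⟩, rfl⟩

/-- A set whose directions form an `H^n`-null subset of the sphere in `ℝ^{n+1}` is
Lebesgue-null. -/
lemma volume_eq_zero_of_hausdorffMeasure_directions_eq_zero {n : ℕ}
    {K S : Set (EuclideanSpace ℝ (Fin (n + 1)))} (hK : 0 ∉ K) (hKS : ∀ x ∈ K, ‖x‖⁻¹ • x ∈ S)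
    (hS : Measure.hausdorffMeasure (n : ℝ) S = 0) : volume K = 0 := by
  have hchart : ∀ i : Fin (n + 1), volume (K ∩ {x | x i ≠ 0}) = 0 := by
    intro i
    -- Projective coordinates: `g` is homogeneous of degree `0`, so a point and its direction have
    -- the same image.
    let g : EuclideanSpace ℝ (Fin (n + 1)) → Fin n → ℝ := fun x j => x (i.succAbove j) / x i
    have hN : volume (g '' (S ∩ {x | x i ≠ 0})) = 0 := by
      rw [← hausdorffMeasure_pi_real]
      refine hausdorffMeasure_image_eq_zero_of_contDiffAt (by positivity) ?_ ?_
      · intro x hx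
        refine contDiffAt_pi.2 fun j => ContDiffAt.div ?_ ?_ hx.2 <;> fun_prop
      · simpa using measure_mono_null Set.inter_subset_left hS
    -- The cone is a differentiable image, between spaces of equal dimension, of the null set `ℝ ×
    -- g(S)`.
    have hcone : volume ((fun p : ℝ × (Fin n → ℝ) => (p.1, p.1 • p.2)) ''
        (Set.univ ×ˢ (g '' (S ∩ {x | x i ≠ 0})))) = 0 := by
      rw [Measure.volume_eq_prod]
      refine addHaar_image_eq_zero_of_differentiableOn_of_addHaar_eq_zero _ (by fun_prop) ?_
      rw [Measure.prod_prod, hN, mul_zero]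
    have hmp : MeasurePreserving (fun x : EuclideanSpace ℝ (Fin (n + 1)) =>
        MeasurableEquiv.piFinSuccAbove (fun _ => ℝ) i (WithLp.ofLp x)) :=
      (volume_preserving_piFinSuccAbove (fun _ => ℝ) i).comp
        (PiLp.volume_preserving_ofLp (Fin (n + 1)))
    refine measure_mono_null ?_ (hmp.quasiMeasurePreserving.preimage_null hcone)
    rintro x ⟨hxK, hxi⟩
    have hx0 : ‖x‖ ≠ 0 := norm_ne_zero_iff.2 fun h => hK (h ▸ hxK)
    refine ⟨(x i, g (‖x‖⁻¹ • x)), ⟨trivial, _, ⟨hKS x hxK, ?_⟩, rfl⟩, ?_⟩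
    · simpa [hx0] using hxi
    · have hxi' : x i ≠ 0 := hxi
      refine Prod.ext rfl (funext fun j => ?_)
      simp [g, Fin.removeNth]
      field_simp
  refine measure_mono_null (fun x hx => ?_) (measure_iUnion_null hchart)
  have hx0 : x ≠ 0 := fun h => hK (h ▸ hx)
  by_contra hcon
  refine hx0 (PiLp.ext fun i => ?_)
  by_contra hi
  exact hcon (Set.mem_iUnion.2 ⟨i, hx, hi⟩)

/-! ### Difference sets and directions -/

/-- The difference set of the supports of two measures whose Fourier transforms decay faster
than `|ξ|^{-d/4}` has positive Lebesgue measure. -/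
lemma volume_sub_pos_of_fourier_decay {d : ℕ} {μ₁ μ₂ : Measure (EuclideanSpace ℝ (Fin d))}
    [IsFiniteMeasure μ₁] [IsFiniteMeasure μ₂] {s : ℝ} (hs0 : 0 < s) (hs : (d : ℝ) < 2 * s)
    (h₁ : ∀ ξ : EuclideanSpace ℝ (Fin d), ξ ≠ 0 → ‖measureFourier μ₁ ξ‖ ≤ ‖ξ‖ ^ (-s / 2))
    (h₂ : ∀ ξ : EuclideanSpace ℝ (Fin d), ξ ≠ 0 → ‖measureFourier μ₂ ξ‖ ≤ ‖ξ‖ ^ (-s / 2))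
    {K₁ K₂ : Set (EuclideanSpace ℝ (Fin d))} (hK₁ : IsCompact K₁) (hK₂ : IsCompact K₂)
    (hμ₁ : μ₁ K₁ ≠ 0) (hμ₂ : μ₂ K₂ ≠ 0) :
    0 < volume ((fun p : EuclideanSpace ℝ (Fin d) × EuclideanSpace ℝ (Fin d) => p.1 - p.2) ''
      (K₁ ×ˢ K₂)) := by
  have hdecay : ∀ ξ : EuclideanSpace ℝ (Fin d), ξ ≠ 0 →
      ‖measureFourier ((μ₁.prod μ₂).map fun p => p.1 - p.2) ξ‖ ≤ ‖ξ‖ ^ (-s) := by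
    intro ξ hξ
    rw [measureFourier_map_sub_prod, norm_mul]
    have h := h₂ (-ξ) (neg_ne_zero.2 hξ)
    rw [norm_neg] at h
    refine (mul_le_mul (h₁ ξ hξ) h (norm_nonneg _) (by positivity)).trans (le_of_eq ?_)
    rw [← Real.rpow_add (norm_pos_iff.2 hξ)]
    ring_nf
  have hKc : IsCompact ((fun p : EuclideanSpace ℝ (Fin d) × EuclideanSpace ℝ (Fin d) =>
      p.1 - p.2) '' (K₁ ×ˢ K₂)) := (hK₁.prod hK₂).image (by fun_prop)
  refine pos_iff_ne_zero.2 fun h0 => ?_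
  have h := measure_eq_zero_of_integrable_measureFourier_sq _
    (integrable_norm_measureFourier_sq _ hs0 hs hdecay) hKc h0
  rw [Measure.map_apply (by fun_prop) hKc.measurableSet] at h
  have h' := measure_mono_null (Set.subset_preimage_image _ _) h
  rw [Measure.prod_prod] at h'
  exact (mul_ne_zero hμ₁ hμ₂) h'

lemma IsMeasureOn.exists_isCompact_measure_ne_zero {d : ℕ} {E : Set (EuclideanSpace ℝ (Fin d))}
    {μ : Measure (EuclideanSpace ℝ (Fin d))} (h : IsMeasureOn E μ) :
    ∃ K ⊆ E, IsCompact K ∧ μ K ≠ 0 := by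
  obtain ⟨K, hKE, hK, hK0⟩ := h.support
  refine ⟨K, hKE, hK, fun h0 => h.ne_zero (Measure.measure_univ_eq_zero.1 ?_)⟩
  rw [← Set.union_compl_self K]
  exact measure_union_null h0 hK0

theorem theorem1p4 (d : ℕ) (E E₁ E₂ : Set (EuclideanSpace ℝ (Fin d)))
    (hE : E = E₁ ∪ E₂) (hdisj : Disjoint E₁ E₂)
    (hE₁ : IsCompact E₁) (hE₂ : IsCompact E₂)
    (hS₁ : IsSalem E₁) (hS₂ : IsSalem E₂)
    (hd₁ : (d : ℝ≥0∞) / 2 < dimH E₁) (hd₂ : (d : ℝ≥0∞) / 2 < dimH E₂) :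
    0 < (Measure.hausdorffMeasure ((d : ℝ) - 1) : Measure (EuclideanSpace ℝ (Fin d)))
      (directionSet E) := by
  obtain ⟨s, hs0, hds, hsE⟩ := ENNReal.lt_iff_exists_real_btwn.1 (lt_min hd₁ hd₂)
  have hds' : (d : ℝ) < 2 * s := by
    rw [← ENNReal.ofReal_natCast, ← ENNReal.ofReal_ofNat 2,
      ← ENNReal.ofReal_div_of_pos (by norm_num), ENNReal.ofReal_lt_ofReal_iff'] at hds
    linarith [hds.1]
  have hs : 0 < s := by
    have : (0 : ℝ) ≤ d := Nat.cast_nonneg d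
    linarith
  obtain ⟨μ₁, hμ₁, hF₁⟩ := hS₁ s hs (hsE.trans_le (min_le_left _ _))
  obtain ⟨μ₂, hμ₂, hF₂⟩ := hS₂ s hs (hsE.trans_le (min_le_right _ _))
  obtain ⟨K₁, hKE₁, hK₁, hm₁⟩ := hμ₁.exists_isCompact_measure_ne_zero
  obtain ⟨K₂, hKE₂, hK₂, hm₂⟩ := hμ₂.exists_isCompact_measure_ne_zero
  have := hμ₁.finite
  have := hμ₂.finite
  have hpos := volume_sub_pos_of_fourier_decay hs hds' hF₁ hF₂ hK₁ hK₂ hm₁ hm₂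
  have hne : ∀ x ∈ K₁, ∀ y ∈ K₂, x ≠ y := fun x hx y hy h =>
    Set.disjoint_left.1 hdisj (hKE₁ hx) (h ▸ hKE₂ hy)
  -- For `d = 0` the dimension hypothesis fails; otherwise `d - 1` is the natural number `n`.
  obtain _ | n := d
  · rw [dimH_subsingleton (Set.subsingleton_of_subsingleton)] at hd₁
    exact absurd hd₁ not_lt_zero
  refine pos_iff_ne_zero.2 fun h0 => hpos.ne'
    (volume_eq_zero_of_hausdorffMeasure_directions_eq_zero (S := directionSet E) ?_ ?_
      (by simpa using h0))
  · rintro ⟨⟨x, y⟩, ⟨hx, hy⟩, hxy⟩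
    exact hne x hx y hy (sub_eq_zero.1 hxy)
  · rintro _ ⟨⟨x, y⟩, ⟨hx, hy⟩, rfl⟩
    exact ⟨x, hE ▸ Or.inl (hKE₁ hx), y, hE ▸ Or.inr (hKE₂ hy), hne x hx y hy, rfl⟩
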